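/- Theorem 1 (Quantum Nash Equilibrium Theorem). Every static $N$-player quantum game has at least one Nash equilibrium. Here a static $N$-player quantum game is given by the following data: numbers of qubits $q_1,\dots,q_N$ (player $k$ receives $q_k$ qubits, with state space $\mathbb{C}^{2^{q_k}}$); an initial state $\rho$, i.e. a positive semidefinite operator of trace $1$ on $\bigotimes_{k=1}^N\mathbb{C}^{2^{q_k}}$; finitely many measurement operators $M_1,\dots,M_L$ on this space with $\sum_m M_m^\dagger M_m=I$; and real payoffs $a^k_m$ for each player $k$ and outcome $m$. For each player $k$ fix any basis $(\tilde E^k_\alpha)_{1\le\alpha\le 4^{q_k}}$ of the space of operators on $\mathbb{C}^{2^{q_k}}$. The strategy set $\Omega_k$ of player $k$ is the set of positive semidefinite Hermitian $4^{q_k}\times 4^{q_k}$ matrices $\chi$ (the chi-matrices of the trace-preserving completely positive maps) such that $$\sum_{\alpha,\beta}\overline{\chi_{\alpha\beta}}\,(\tilde E^k_\alpha)^\dagger\tilde E^k_\beta=I .$$ Put $R^k=\sum_m a^k_m M_m^\dagger M_m$. The payoff of player $k$ at the profile $\vec\chi=(\chi^1,\dots,\chi^N)$ is $$P_k(\vec\chi)=\sum_{\alpha_1,\dots,\alpha_N,\beta_1,\dots,\beta_N}\mathrm{Re}\Big[\chi^1_{\alpha_1\beta_1}\cdots\chi^N_{\alpha_N\beta_N}\,\mathrm{tr}\big(R^k\,(\tilde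 E^1_{\alpha_1}\otimes\cdots\otimes\tilde E^N_{\alpha_N})\,\rho\,(\tilde E^1_{\beta_1}\otimes\cdots\otimes\tilde E^N_{\beta_N})^\dagger\big)\Big].$$ A Nash equilibrium is a profile $\vec\chi\in\Omega_1\times\cdots\times\Omega_N$ such that, for every player $k$ and every $\chi'\in\Omega_k$, the payoff $P_k(\vec\chi)$ is at least the payoff $P_k$ of the profile obtained from $\vec\chi$ by replacing $\chi^k$ with $\chi'$. -/

import Mathlib

open scoped Matrix ComplexOrder

noncomputable section

/-- The data of a static quantum game with `N` players. Player `k` receives `q k` qubits, so that the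
joint system is the tensor product of the spaces `ℂ ^ (2 ^ q k)`, whose computational basis is indexed
by tuples `i` with `i k : Fin (2 ^ q k)`. -/
structure StaticQuantumGame (N : ℕ) where
  /-- number of qubits sent to each player -/
  q : Fin N → ℕ
  /-- initial state -/
  ρ : Matrix (∀ k, Fin (2 ^ q k)) (∀ k, Fin (2 ^ q k)) ℂ
  ρ_posSemidef : ρ.PosSemidef
  ρ_trace : ρ.trace = 1
  /-- number of measurement outcomes -/
  L : ℕ
  /-- measurement operators of the referee; outcome `m` has the POVM element `(M m)ᴴ * M m` -/
  M : Fin L → Matrix (∀ k, Fin (2 ^ q k)) (∀ k, Fin (2 ^ q k)) ℂ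
  M_complete : ∑ m, (M m)ᴴ * M m = 1
  /-- `a k m` is the payoff of player `k` at the measurement outcome `m` -/
  a : Fin N → Fin L → ℝ

namespace StaticQuantumGame

variable {N : ℕ} (G : StaticQuantumGame N)

/-- Operators on the qubits of player `k`. -/
abbrev LocalOp (k : Fin N) : Type := Matrix (Fin (2 ^ G.q k)) (Fin (2 ^ G.q k)) ℂ

/-- Operators on the joint system. -/
abbrev JointOp : Type := Matrix (∀ k, Fin (2 ^ G.q k)) (∀ k, Fin (2 ^ G.q k)) ℂ

/-- A choice, for each player `k`, of a basis `E k α` of the operators on the qubits of that player. -/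
abbrev OpBasis : Type := ∀ k, Module.Basis (Fin (4 ^ G.q k)) ℂ (G.LocalOp k)

/-- Matrices of the size of a chi-matrix of player `k`. -/
abbrev Chi (k : Fin N) : Type := Matrix (Fin (4 ^ G.q k)) (Fin (4 ^ G.q k)) ℂ

/-- The payoff observable `R k = ∑ m, a k m • (M m)ᴴ * M m` of player `k`. -/
def R (k : Fin N) : G.JointOp := ∑ m, (G.a k m : ℂ) • ((G.M m)ᴴ * G.M m)

/-- The tensor product of one operator per player. -/
def tensor (T : ∀ k, G.LocalOp k) : G.JointOp := Matrix.of fun i j => ∏ k, T k (i k) (j k)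

/-- The strategy set of player `k`: the positive semidefinite Hermitian matrices `χ` with
`∑ α β, conj (χ α β) • (E α)ᴴ * E β = 1`, that is, the chi-matrices of the trace-preserving completely
positive maps. -/
def Ω (E : G.OpBasis) (k : Fin N) : Set (G.Chi k) :=
  {χ | χ.PosSemidef ∧ ∑ α, ∑ β, star (χ α β) • ((E k α)ᴴ * E k β) = 1}

/-- The coefficient tensor
`A k α β = tr (R k * (⨂ j, E j (α j)) * ρ * (⨂ j, E j (β j))ᴴ)` of player `k`. -/
def A (E : G.OpBasis) (k : Fin N) (α β : ∀ j, Fin (4 ^ G.q j)) : ℂ :=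
  (G.R k * G.tensor (fun j => E j (α j)) * G.ρ * (G.tensor fun j => E j (β j))ᴴ).trace

/-- The payoff of player `k` at the profile `χ`. -/
def payoff (E : G.OpBasis) (k : Fin N) (χ : ∀ j, G.Chi j) : ℝ :=
  ∑ α : (∀ j, Fin (4 ^ G.q j)), ∑ β : (∀ j, Fin (4 ^ G.q j)),
    ((∏ j, χ j (α j) (β j)) * G.A E k α β).re

/-- The set of best replies of player `k` to the strategies of the other players in the profile `χ`
(the component `χ k` is irrelevant, since it is overwritten). -/
def bestReplies (E : G.OpBasis) (k : Fin N) (χ : ∀ j, G.Chi j) : Set (G.Chi k) :=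
  {x | x ∈ G.Ω E k ∧ ∀ y ∈ G.Ω E k,
    G.payoff E k (Function.update χ k x) ≥ G.payoff E k (Function.update χ k y)}

/-- A profile of strategies is a Nash equilibrium if each of its components is a best reply to the
others. -/
def IsNashEquilibrium (E : G.OpBasis) (χ : ∀ j, G.Chi j) : Prop :=
  ∀ k, χ k ∈ G.bestReplies E k χ

end StaticQuantumGame

end

/-! Each payoff is the real part of a multilinear form, so it is real-linear in the player's own
chi-matrix. Put L χ ψ = ∑ k, P_k(χ with component k replaced by ψ k), which is linear in ψ. If χ
maximizes L χ over ∏ Ω_k, then comparing χ with profiles that differ from it in one component shows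
that χ is an equilibrium.

Such a χ exists by `exists_forall_apply_le_apply_self`, since each Ω_k is nonempty, convex and
compact. Compactness comes from `Ω_eq_image`: factoring χ as a Gram matrix exhibits Ω_k as a
continuous image of the Kraus families with ∑ (T l)ᴴ * T l = 1, a closed bounded set.

For the variational inequality, compactness leaves finitely many test points, and Nash's map on
their simplex has a Brouwer fixed point. Brouwer's theorem is derived from Scarf's lemma, a parity
argument about dominant sets, applied to grid points of a simplex ranked by their coordinates. -/

section Scarf

/-! ### Scarf's lemma: parity of dominant sets -/

variable {X I : Type*}

/-- A set `σ` is dominant for a family of rankings `r` if no point strictly outranks, in every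
ranking, the lowest point of `σ`. -/
def IsDominantSet (r : I → X → ℕ) (σ : Finset X) : Prop :=
  ∀ y, ∃ i, ∀ x ∈ σ, r i y ≤ r i x

theorem exists_rank_minimizers (r : I → X → ℕ) {τ : Finset X} (hτ : τ.Nonempty) :
    ∃ m : I → X, ∀ i, m i ∈ τ ∧ ∀ z ∈ τ, r i (m i) ≤ r i z := by
  have h := fun i => τ.exists_min_image (r i) hτ
  choose m hm using h
  exact ⟨m, hm⟩

variable [DecidableEq X]

theorem exists_eq_insert_of_card {τ σ : Finset X} {n : ℕ} (h : τ ⊆ σ) (hτ : τ.card + 1 = n)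
    (hσ : σ.card = n) : ∃ x, x ∉ τ ∧ σ = insert x τ := by
  obtain ⟨x, hx, hxs⟩ := (Finset.covBy_iff_exists_insert (s := τ) (t := σ)).1 (by
    rw [Finset.covBy_iff_card_sdiff_eq_one]
    refine ⟨h, ?_⟩
    rw [Finset.card_sdiff_of_subset h]; omega)
  exact ⟨x, hx, hxs.symm⟩

variable [Fintype I]

/-- A dominant set with as many elements as there are rankings. -/
def IsScarfCell (r : I → X → ℕ) (σ : Finset X) : Prop :=
  IsDominantSet r σ ∧ σ.card = Fintype.card I

/-- In a cell every point is lowest in exactly one ranking. Deleting `x`, lowest in ranking `a`,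
passes that role to a point already lowest in some ranking `b`; this is the only coincidence among
the minimizers of `τ`. -/
theorem IsScarfCell.direction {r : I → X → ℕ} (hr : ∀ i, Function.Injective (r i))
    {τ : Finset X} {x : X} (hx : x ∉ τ) (hσ : IsScarfCell r (insert x τ))
    {m : I → X} (hm : ∀ i, m i ∈ τ ∧ ∀ z ∈ τ, r i (m i) ≤ r i z) :
    ∃ a b, a ≠ b ∧ m a = m b ∧ r a x < r a (m a) ∧ (∀ k, k ≠ a → r k (m k) < r k x) ∧
      (∀ k l, k ≠ a → l ≠ a → m k = m l → k = l) ∧ ∀ z ∈ τ, ∃ k, k ≠ a ∧ m k = z := by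
  obtain ⟨μ, hμ⟩ := exists_rank_minimizers r (Finset.insert_nonempty x τ)
  -- Dominance tested on a point of the cell itself says that this point is lowest in some ranking.
  have himg : Finset.univ.image μ = insert x τ := by
    apply Finset.Subset.antisymm
    · intro z hz
      obtain ⟨i, -, rfl⟩ := Finset.mem_image.1 hz
      exact (hμ i).1
    · intro z hz
      obtain ⟨i, hi⟩ := hσ.1 z
      exact Finset.mem_image.2 ⟨i, Finset.mem_univ _,
        hr i (le_antisymm ((hμ i).2 z hz) (hi _ (hμ i).1))⟩
  have hinj : Function.Injective μ := by
    have : (Finset.univ.image μ).card = (Finset.univ : Finset I).card := by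
      rw [himg, hσ.2, Finset.card_univ]
    have := Finset.card_image_iff.1 this
    exact fun i j h => this (by simp) (by simp) h
  have hsurj : ∀ z ∈ insert x τ, ∃ i, μ i = z := by
    intro z hz
    rw [← himg] at hz
    simpa using hz
  obtain ⟨a, ha⟩ := hsurj x (Finset.mem_insert_self _ _)
  have hk : ∀ k, k ≠ a → μ k = m k := by
    intro k hka
    have h1 : μ k ∈ τ := by
      refine (Finset.mem_insert.1 (hμ k).1).resolve_left fun h => hka (hinj (h.trans ha.symm))
    exact hr k (le_antisymm ((hμ k).2 _ (Finset.mem_insert_of_mem (hm k).1)) ((hm k).2 _ h1))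
  have hmax : m a ≠ x := fun h => hx (h ▸ (hm a).1)
  obtain ⟨b, hb⟩ := hsurj (m a) (Finset.mem_insert_of_mem (hm a).1)
  have hab : a ≠ b := fun h => hmax (by rw [← hb, ← h, ha])
  refine ⟨a, b, hab, by rw [← hk b hab.symm, hb], ?_, ?_, ?_, ?_⟩
  · have h1 := (hμ a).2 _ (Finset.mem_insert_of_mem (hm a).1)
    rw [ha] at h1
    exact lt_of_le_of_ne h1 fun h => hmax (hr a h).symm
  · intro k hka
    have h1 := (hμ k).2 x (Finset.mem_insert_self _ _)
    rw [hk k hka] at h1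
    exact lt_of_le_of_ne h1 fun h => hx (hr k h ▸ (hm k).1)
  · intro k l hka hla h
    rw [← hk k hka, ← hk l hla] at h
    exact hinj h
  · intro z hz
    obtain ⟨k, hkz⟩ := hsurj z (Finset.mem_insert_of_mem hz)
    have hka : k ≠ a := by
      rintro rfl
      exact hx (by rw [← ha, hkz]; exact hz)
    exact ⟨k, hka, by rw [← hk k hka, hkz]⟩

/-- Two cells over `τ` with the same direction `a` bound each other's new vertex in ranking `a`, so
the direction determines the cell. -/
theorem IsScarfCell.le_of_direction {r : I → X → ℕ} {τ : Finset X} {x x' : X}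
    (hσ : IsScarfCell r (insert x τ)) {m : I → X} (hm : ∀ i, m i ∈ τ) {a : I}
    (hx' : ∀ k, k ≠ a → r k (m k) < r k x') : r a x' ≤ r a x := by
  obtain ⟨i, hi⟩ := hσ.1 x'
  by_cases hia : i = a
  · subst hia
    exact hi x (Finset.mem_insert_self _ _)
  · exact absurd (hi _ (Finset.mem_insert_of_mem (hm i))) (not_le.2 (hx' i hia))

variable [Fintype X]

/-- Pivot step: the new vertex is the `r b`-highest point lying above the minimizers of `τ` in all
rankings but `b`. -/
theorem IsScarfCell.exists_opposite {r : I → X → ℕ}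
    {τ : Finset X} {x : X} (hx : x ∉ τ) (hσ : IsScarfCell r (insert x τ))
    {m : I → X} (hm : ∀ i, m i ∈ τ ∧ ∀ z ∈ τ, r i (m i) ≤ r i z) {a b : I}
    (hab : a ≠ b) (hmab : m a = m b)
    (hsurj : ∀ z ∈ τ, ∃ k, k ≠ a ∧ m k = z)
    (hne : ∃ y, ∀ k, k ≠ b → r k (m k) < r k y) :
    ∃ x', x' ∉ τ ∧ IsScarfCell r (insert x' τ) ∧ ∀ k, k ≠ b → r k (m k) < r k x' := by
  classical
  obtain ⟨x', hx', hmax⟩ := Finset.exists_max_image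
    (Finset.univ.filter fun y => ∀ k, k ≠ b → r k (m k) < r k y) (r b) (by obtain ⟨y, hy⟩ := hne; exact ⟨y, by simpa using hy⟩)
  simp only [Finset.mem_filter, Finset.mem_univ, true_and] at hx' hmax
  have hx'τ : x' ∉ τ := by
    intro h
    obtain ⟨k, hka, hk⟩ := hsurj x' h
    by_cases hkb : k = b
    · have := hx' a hab
      rw [hmab, ← hkb, hk] at this
      exact lt_irrefl _ this
    · have := hx' k hkb
      rw [hk] at this
      exact lt_irrefl _ this
  have hx'b : r b x' ≤ r b (m b) := by
    obtain ⟨i, hi⟩ := hσ.1 x'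
    by_cases hib : i = b
    · subst hib
      exact hi _ (Finset.mem_insert_of_mem (hm i).1)
    · exact absurd (hi _ (Finset.mem_insert_of_mem (hm i).1)) (not_le.2 (hx' i hib))
  refine ⟨x', hx'τ, ⟨?_, ?_⟩, hx'⟩
  · intro y
    by_cases hy : ∀ k, k ≠ b → r k (m k) < r k y
    · refine ⟨b, fun z hz => ?_⟩
      rcases Finset.mem_insert.1 hz with rfl | hz
      · exact hmax y hy
      · exact (hmax y hy).trans (hx'b.trans ((hm b).2 z hz))
    · push Not at hy
      obtain ⟨k, hkb, hk⟩ := hy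
      refine ⟨k, fun z hz => ?_⟩
      rcases Finset.mem_insert.1 hz with rfl | hz
      · exact hk.trans (hx' k hkb).le
      · exact hk.trans ((hm k).2 z hz)
  · rw [← hσ.2, Finset.card_insert_of_notMem hx'τ, Finset.card_insert_of_notMem hx]

open Classical in
-- If one cell contains `τ`, there are exactly two, one for each index of the coinciding pair `a`,
-- `b`. The slack point `s b` makes the pivot possible, because `τ` contains a non-slack point.
theorem even_card_scarfCells {r : I → X → ℕ} (hr : ∀ i, Function.Injective (r i)) {s : I → X}
    (hs : ∀ i k y, k ≠ i → y ∉ Set.range s → r i y < r i (s k))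
    {τ : Finset X} (hcard : τ.card + 1 = Fintype.card I) (hτ : ∃ y ∈ τ, y ∉ Set.range s) :
    Even (Finset.univ.filter fun σ => IsScarfCell r σ ∧ τ ⊆ σ).card := by
  obtain ⟨y₀, hy₀, hy₀s⟩ := hτ
  obtain ⟨m, hm⟩ := exists_rank_minimizers r ⟨y₀, hy₀⟩
  by_cases hex : ∃ σ, IsScarfCell r σ ∧ τ ⊆ σ
  · obtain ⟨σ, hσ, hτσ⟩ := hex
    obtain ⟨x, hx, rfl⟩ := exists_eq_insert_of_card hτσ hcard hσ.2
    obtain ⟨a, b, hab, hmab, hxa, hxk, hinj, hsurj⟩ := hσ.direction hr hx hm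
    have hne : ∃ y, ∀ k, k ≠ b → r k (m k) < r k y :=
      ⟨s b, fun k hk => ((hm k).2 _ hy₀).trans_lt (hs k b y₀ hk.symm hy₀s)⟩
    obtain ⟨x', hx', hσ', hxk'⟩ := hσ.exists_opposite hx hm hab hmab hsurj hne
    have hxx' : x ≠ x' := by
      rintro rfl
      exact lt_asymm hxa (hxk' a hab)
    have : (Finset.univ.filter fun σ => IsScarfCell r σ ∧ τ ⊆ σ) = {insert x τ, insert x' τ} := by
      ext σ
      simp only [Finset.mem_filter, Finset.mem_univ, true_and, Finset.mem_insert,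
        Finset.mem_singleton]
      constructor
      · rintro ⟨h1, h2⟩
        obtain ⟨w, hw, rfl⟩ := exists_eq_insert_of_card h2 hcard h1.2
        obtain ⟨a', b', hab', hmab', -, hwk, hinj', -⟩ := h1.direction hr hw hm
        -- The direction of any cell over `τ` belongs to the unique coinciding pair.
        have : a' = a ∨ a' = b := by
          by_contra! hcon
          by_cases hb' : b' = a
          · exact hcon.2 (hinj a' b hcon.1 hab.symm (by rw [hmab', hb', hmab]))
          · exact hab' (hinj a' b' hcon.1 hb' hmab')
        rcases this with rfl | rfl
        · left
          rw [hr a' (le_antisymm (hσ.le_of_direction (fun i => (hm i).1) hwk)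
            (h1.le_of_direction (fun i => (hm i).1) hxk))]
        · right
          rw [hr a' (le_antisymm (hσ'.le_of_direction (fun i => (hm i).1) hwk)
            (h1.le_of_direction (fun i => (hm i).1) hxk'))]
      · rintro (rfl | rfl)
        · exact ⟨hσ, Finset.subset_insert _ _⟩
        · exact ⟨hσ', Finset.subset_insert _ _⟩
    rw [this, Finset.card_pair]
    · exact even_two
    · intro h
      have : x ∈ insert x' τ := h ▸ Finset.mem_insert_self _ _
      exact (Finset.mem_insert.1 this).elim hxx' hx
  · rw [Finset.card_eq_zero.2]
    · exact Even.zero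
    · exact Finset.filter_eq_empty_iff.2 fun σ _ h => hex ⟨σ, h⟩

variable [DecidableEq I]

open Classical in
-- The missing vertex is forced to be the `r i₀`-highest non-slack point.
theorem card_scarfCells_slack {r : I → X → ℕ} (hr : ∀ i, Function.Injective (r i)) {s : I → X}
    (hs_inj : Function.Injective s) (hs_min : ∀ i y, r i (s i) ≤ r i y)
    (hs : ∀ i k y, k ≠ i → y ∉ Set.range s → r i y < r i (s k))
    (hX : ∃ y, y ∉ Set.range s) (i₀ : I) :
    (Finset.univ.filter fun σ => IsScarfCell r σ ∧ (Finset.univ.erase i₀).image s ⊆ σ).card = 1 := by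
  set τ := (Finset.univ.erase i₀).image s with hτ
  have hcard : τ.card + 1 = Fintype.card I := by
    rw [hτ, Finset.card_image_of_injective _ hs_inj, Finset.card_erase_add_one (Finset.mem_univ _),
      Finset.card_univ]
  have hmem : ∀ k, k ≠ i₀ → s k ∈ τ := fun k hk =>
    Finset.mem_image_of_mem _ (Finset.mem_erase.2 ⟨hk, Finset.mem_univ _⟩)
  have hslack : ∀ y, y ∉ Set.range s → ∀ k, r k (s k) < r k y := fun y hy k =>
    lt_of_le_of_ne (hs_min k y) fun h => hy ⟨k, hr k h⟩
  obtain ⟨x, hx, hmax⟩ := (Finset.univ.filter fun y => y ∉ Set.range s).exists_max_image (r i₀)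
    (by obtain ⟨y, hy⟩ := hX; exact ⟨y, by simpa using hy⟩)
  simp only [Finset.mem_filter, Finset.mem_univ, true_and] at hx hmax
  have hxτ : x ∉ τ := by
    intro h
    obtain ⟨k, -, rfl⟩ := Finset.mem_image.1 h
    exact hx ⟨k, rfl⟩
  rw [Finset.card_eq_one]
  refine ⟨insert x τ, ?_⟩
  ext σ
  simp only [Finset.mem_filter, Finset.mem_univ, true_and, Finset.mem_singleton]
  constructor
  · rintro ⟨h1, h2⟩
    obtain ⟨w, hw, rfl⟩ := exists_eq_insert_of_card h2 hcard h1.2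
    have key : ∀ y, y ∉ Set.range s → r i₀ y ≤ r i₀ w := by
      intro y hy
      obtain ⟨i, hi⟩ := h1.1 y
      by_cases hi₀ : i = i₀
      · subst hi₀
        exact hi _ (Finset.mem_insert_self _ _)
      · exact absurd (hi _ (Finset.mem_insert_of_mem (hmem i hi₀))) (not_le.2 (hslack y hy i))
    have hws : w ∉ Set.range s := by
      rintro ⟨k, rfl⟩
      have hk : k = i₀ := by
        by_contra hk
        exact hw (hmem k hk)
      subst hk
      exact absurd (key x hx) (not_le.2 (hslack x hx k))
    rw [hr i₀ (le_antisymm (key x hx) (hmax w hws))]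
  · rintro rfl
    refine ⟨⟨fun y => ?_, ?_⟩, Finset.subset_insert _ _⟩
    · by_cases hy : y ∈ Set.range s
      · obtain ⟨k, rfl⟩ := hy
        exact ⟨k, fun z _ => hs_min k z⟩
      · refine ⟨i₀, fun z hz => ?_⟩
        rcases Finset.mem_insert.1 hz with rfl | hz
        · exact hmax y hy
        · obtain ⟨k, hk, rfl⟩ := Finset.mem_image.1 hz
          exact (hs i₀ k y (Finset.ne_of_mem_erase hk) hy).le
    · rw [Finset.card_insert_of_notMem hxτ, hcard]

open Classical in
-- A cell that is not colorful but has a door repeats exactly one color; its doors arise by deleting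
-- either of the two points of that color.
theorem even_card_doors {c : X → I} {i₀ : I} {σ : Finset X} (hσ : σ.card = Fintype.card I)
    (hc : σ.image c ≠ Finset.univ) :
    Even (Finset.univ.filter fun τ : Finset X =>
      (τ.card + 1 = Fintype.card I ∧ τ.image c = Finset.univ.erase i₀) ∧ τ ⊆ σ).card := by
  by_cases hex : ∃ τ : Finset X,
      (τ.card + 1 = Fintype.card I ∧ τ.image c = Finset.univ.erase i₀) ∧ τ ⊆ σ
  · obtain ⟨τ, ⟨hcard, himg⟩, hτσ⟩ := hex
    obtain ⟨x, hx, rfl⟩ := exists_eq_insert_of_card hτσ hcard hσ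
    have hinj : Set.InjOn c τ := by
      apply Finset.card_image_iff.1
      rw [himg]
      have := Finset.card_erase_add_one (Finset.mem_univ i₀)
      rw [Finset.card_univ] at this
      omega
    have hcx : c x ∈ τ.image c := by
      rw [himg, Finset.mem_erase]
      refine ⟨fun h => hc ?_, Finset.mem_univ _⟩
      rw [Finset.image_insert, himg, h, Finset.insert_erase (Finset.mem_univ _)]
    obtain ⟨x', hx', hcx'⟩ := Finset.mem_image.1 hcx
    have hxx' : x ≠ x' := fun h => hx (h ▸ hx')
    have hcard' : ((insert x τ).erase x').card + 1 = Fintype.card I := by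
      rw [Finset.card_erase_add_one (Finset.mem_insert_of_mem hx'), hσ]
    have himg' : ((insert x τ).erase x').image c = Finset.univ.erase i₀ := by
      rw [← himg]
      ext i
      simp only [Finset.mem_image, Finset.mem_erase, Finset.mem_insert]
      constructor
      · rintro ⟨z, ⟨hz, rfl | hz'⟩, rfl⟩
        · exact ⟨x', hx', hcx'⟩
        · exact ⟨z, hz', rfl⟩
      · rintro ⟨z, hz, rfl⟩
        by_cases hzx : z = x'
        · exact ⟨x, ⟨hxx', Or.inl rfl⟩, by rw [hzx, hcx']⟩
        · exact ⟨z, ⟨hzx, Or.inr hz⟩, rfl⟩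
    have : (Finset.univ.filter fun τ' : Finset X => (τ'.card + 1 = Fintype.card I ∧
        τ'.image c = Finset.univ.erase i₀) ∧ τ' ⊆ insert x τ) = {τ, (insert x τ).erase x'} := by
      ext τ'
      simp only [Finset.mem_filter, Finset.mem_univ, true_and, Finset.mem_insert,
        Finset.mem_singleton]
      constructor
      · rintro ⟨⟨h1, h2⟩, h3⟩
        obtain ⟨w, hw, hw'⟩ := exists_eq_insert_of_card h3 h1 hσ
        have hτ' : τ' = (insert x τ).erase w := by rw [hw', Finset.erase_insert hw]
        by_cases hwx : w = x
        · left
          rw [hτ', hwx, Finset.erase_insert hx]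
        · right
          have hwτ : w ∈ τ := by
            have : w ∈ insert x τ := hw' ▸ Finset.mem_insert_self _ _
            exact (Finset.mem_insert.1 this).resolve_left hwx
          have : c w ∈ τ'.image c := by
            rw [h2, ← himg]
            exact Finset.mem_image_of_mem _ hwτ
          obtain ⟨z, hz, hzw⟩ := Finset.mem_image.1 this
          have hzne : z ≠ w := fun h => hw (h ▸ hz)
          rcases Finset.mem_insert.1 (h3 hz) with rfl | hzτ
          · rw [hτ', hinj hwτ hx' (hzw.symm.trans hcx'.symm)]
          · exact absurd (hinj hzτ hwτ hzw) hzne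
      · rintro (rfl | rfl)
        · exact ⟨⟨hcard, himg⟩, Finset.subset_insert _ _⟩
        · exact ⟨⟨hcard', himg'⟩, Finset.erase_subset _ _⟩
    rw [this, Finset.card_pair]
    · exact even_two
    · intro h
      rw [h] at hx'
      exact Finset.notMem_erase _ _ hx'
  · rw [Finset.card_eq_zero.2]
    · exact Even.zero
    · exact Finset.filter_eq_empty_iff.2 fun σ _ h => hex ⟨σ, h⟩

/-- **Scarf's lemma.** -/
theorem exists_colorful_scarfCell [Nonempty I] {r : I → X → ℕ}
    (hr : ∀ i, Function.Injective (r i)) {s : I → X} (hs_min : ∀ i y, r i (s i) ≤ r i y)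
    (hs : ∀ i k y, k ≠ i → y ∉ Set.range s → r i y < r i (s k))
    (hX : ∃ y, y ∉ Set.range s) {c : X → I} (hc : ∀ i, c (s i) = i) :
    ∃ σ, IsScarfCell r σ ∧ σ.image c = Finset.univ := by
  classical
  by_contra! hcon
  obtain ⟨i₀⟩ := ‹Nonempty I›
  have hs_inj : Function.Injective s := Function.LeftInverse.injective hc
  let cells : Finset (Finset X) := Finset.univ.filter (IsScarfCell r)
  let doors : Finset (Finset X) := Finset.univ.filter fun τ : Finset X =>
    τ.card + 1 = Fintype.card I ∧ τ.image c = Finset.univ.erase i₀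
  let τ₀ : Finset X := (Finset.univ.erase i₀).image s
  have hτ₀ : τ₀ ∈ doors := by
    refine Finset.mem_filter.2 ⟨Finset.mem_univ _, ?_, ?_⟩
    · rw [Finset.card_image_of_injective _ hs_inj, Finset.card_erase_add_one (Finset.mem_univ _),
        Finset.card_univ]
    · rw [Finset.image_image]
      rw [show c ∘ s = id from funext hc, Finset.image_id]
  -- Incidences between doors and cells are counted twice: every cell contributes an even number,
  -- and so does every door except `τ₀`, which contributes 1.
  have hcount := Finset.sum_card_bipartiteAbove_eq_sum_card_bipartiteBelow
    (s := doors) (t := cells) (fun τ σ => τ ⊆ σ)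
  have hright : Even (∑ σ ∈ cells, (doors.bipartiteBelow (fun τ σ => τ ⊆ σ) σ).card) := by
    refine Finset.even_sum _ fun σ hσ => ?_
    have hσ' := (Finset.mem_filter.1 hσ).2
    have := even_card_doors (i₀ := i₀) hσ'.2 (hcon σ hσ')
    rwa [← Finset.filter_filter] at this
  have hleft : Even (∑ τ ∈ doors.erase τ₀, (cells.bipartiteAbove (fun τ σ => τ ⊆ σ) τ).card) := by
    refine Finset.even_sum _ fun τ hτ => ?_
    obtain ⟨hne, hτ⟩ := Finset.mem_erase.1 hτ
    obtain ⟨hcard, himg⟩ := (Finset.mem_filter.1 hτ).2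
    have hy : ∃ y ∈ τ, y ∉ Set.range s := by
      by_contra! hall
      refine hne (Finset.eq_of_subset_of_card_le ?_ ?_)
      · intro z hz
        obtain ⟨k, rfl⟩ := hall z hz
        refine Finset.mem_image_of_mem _ ?_
        rw [← himg]
        exact Finset.mem_image.2 ⟨s k, hz, hc k⟩
      · have := (Finset.mem_filter.1 hτ₀).2.1
        omega
    have := even_card_scarfCells hr hs hcard hy
    rwa [← Finset.filter_filter] at this
  have hone : (cells.bipartiteAbove (fun τ σ => τ ⊆ σ) τ₀).card = 1 := by
    have := card_scarfCells_slack hr hs_inj hs_min hs hX i₀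
    rwa [← Finset.filter_filter] at this
  rw [← Finset.add_sum_erase _ _ hτ₀, hone] at hcount
  rw [← hcount] at hright
  exact absurd hright (by rw [Nat.even_add]; simp [hleft])

end Scarf

/-! ### Brouwer's theorem on the standard simplex -/

section Brouwer

variable {I : Type*} [Fintype I]

/-- Scarf's lemma on the grid points of a dilated simplex. -/
theorem exists_grid_point_near_all_colors [Nonempty I] (n : ℕ) (c : (I → ℕ) → I) :
    ∃ v : I → ℕ, ∑ i, v i = n ∧ ∀ i, v i ≤ Fintype.card I ∨
      ∃ w : I → ℕ, ∑ j, w j = n ∧ c w = i ∧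
        ∀ j, v j ≤ w j + Fintype.card I ∧ w j ≤ v j + Fintype.card I := by
  classical
  let T := {v : I → ℕ // v ∈ Finset.piAntidiag Finset.univ n}
  have : Fintype T := Finset.fintypeCoeSort (Finset.piAntidiag Finset.univ n)
  have hT : ∀ v : T, ∑ i, v.1 i = n := fun v => (Finset.mem_piAntidiag.1 v.2).1
  have hmk : ∀ v : I → ℕ, ∑ i, v i = n → v ∈ Finset.piAntidiag Finset.univ n := fun v hv =>
    Finset.mem_piAntidiag.2 ⟨hv, fun i _ => Finset.mem_univ i⟩
  have hle : ∀ (v : T) i, v.1 i ≤ n := fun v i =>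
    (Finset.single_le_sum (f := v.1) (fun _ _ => Nat.zero_le _) (Finset.mem_univ i)).trans_eq (hT v)
  let M := Fintype.card T
  let e : T ≃ Fin M := Fintype.equivFin T
  let e' : I ≃ Fin (Fintype.card I) := Fintype.equivFin I
  -- Grid points are ranked by their `i`-th coordinate, with ties broken by `e`. Slack `i` lies
  -- below all of them and the other slacks above.
  let r : I → T ⊕ I → ℕ := fun i => Sum.elim (fun v => 1 + (v.1 i * M + e v))
    fun k => if k = i then 0 else 1 + (n + 1) * M + e' k
  have hrv : ∀ i (v : T), 0 < r i (Sum.inl v) ∧ r i (Sum.inl v) < 1 + (n + 1) * M := by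
    intro i v
    have h1 : v.1 i * M ≤ n * M := Nat.mul_le_mul_right _ (hle v i)
    have h2 := (e v).2
    have h3 : (n + 1) * M = n * M + M := by ring
    simp only [r, Sum.elim_inl]
    omega
  have hmono : ∀ i (v w : T), r i (Sum.inl v) ≤ r i (Sum.inl w) → v.1 i ≤ w.1 i := by
    intro i v w h
    simp only [r, Sum.elim_inl] at h
    by_contra! hlt
    have h1 : (w.1 i + 1) * M ≤ v.1 i * M := Nat.mul_le_mul_right _ hlt
    have h2 := (e w).2
    have h3 : (w.1 i + 1) * M = w.1 i * M + M := by ring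
    omega
  have hself : ∀ i, r i (Sum.inr i) = 0 := fun i => by simp [r]
  have hother : ∀ i k, k ≠ i → r i (Sum.inr k) = 1 + (n + 1) * M + e' k := fun i k h => by
    simp [r, h]
  have hinj : ∀ i, Function.Injective (r i) := by
    rintro i (v | k) (w | l) h
    · have h1 := le_antisymm (hmono i v w h.le) (hmono i w v h.ge)
      simp only [r, Sum.elim_inl, h1] at h
      have h2 : (e v : ℕ) = e w := by omega
      rw [e.injective (Fin.ext h2)]
    · exfalso
      have h1 := hrv i v
      by_cases hl : l = i
      · rw [h, hl, hself] at h1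
        omega
      · rw [h, hother i l hl] at h1
        omega
    · exfalso
      have h1 := hrv i w
      by_cases hl : k = i
      · rw [← h, hl, hself] at h1
        omega
      · rw [← h, hother i k hl] at h1
        omega
    · by_cases hk : k = i <;> by_cases hl : l = i
      · rw [hk, hl]
      · rw [hk, hself, hother i l hl] at h
        omega
      · rw [hl, hself, hother i k hk] at h
        omega
      · rw [hother i k hk, hother i l hl] at h
        have h2 : (e' k : ℕ) = e' l := by omega
        rw [e'.injective (Fin.ext h2)]
  obtain ⟨j₀⟩ := ‹Nonempty I›
  let v₀ : T := ⟨Pi.single j₀ n, hmk _ (by simp)⟩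
  obtain ⟨σ, ⟨hdom, -⟩, hcol⟩ := exists_colorful_scarfCell hinj (s := Sum.inr)
    (c := Sum.elim (fun v => c v.1) id) (fun i y => by rw [hself]; exact Nat.zero_le _)
    (by
      rintro i k (v | l) hki hy
      · rw [hother i k hki]
        have := (hrv i v).2
        omega
      · exact absurd ⟨l, rfl⟩ hy)
    ⟨Sum.inl v₀, by simp⟩ (fun i => rfl)
  have hlow : ∀ v : T, ∃ i, Sum.inr i ∉ σ ∧ ∀ z ∈ σ, r i (Sum.inl v) ≤ r i z := by
    intro v
    obtain ⟨i, hi⟩ := hdom (Sum.inl v)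
    refine ⟨i, fun h => ?_, hi⟩
    have h1 := hi _ h
    rw [hself] at h1
    have := (hrv i v).1
    omega
  have hcolor : ∀ i, Sum.inr i ∉ σ → ∃ v : T, Sum.inl v ∈ σ ∧ c v.1 = i := by
    intro i hi
    have : i ∈ σ.image (Sum.elim (fun v : T => c v.1) id) := by
      rw [hcol]
      exact Finset.mem_univ i
    obtain ⟨z, hz, hzi⟩ := Finset.mem_image.1 this
    rcases z with v | k
    · exact ⟨v, hz, hzi⟩
    · exact absurd hz (by rw [show k = i from hzi]; exact hi)
  obtain ⟨i₁, hi₁, -⟩ := hlow v₀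
  obtain ⟨v, hv, -⟩ := hcolor i₁ hi₁
  have hmin := fun i => (Finset.univ.filter fun w : T => Sum.inl w ∈ σ).exists_min_image
    (fun w => w.1 i) ⟨v, by simpa using hv⟩
  simp only [Finset.mem_filter, Finset.mem_univ, true_and] at hmin
  choose μ hμσ hμ using hmin
  -- Coordinatewise lower bound for the grid points of `σ`; a slack in `σ` makes its coordinate
  -- bound 0.
  let m : I → ℕ := fun i => if Sum.inr i ∈ σ then 0 else (μ i).1 i
  have hm : ∀ w : T, Sum.inl w ∈ σ → ∀ i, m i ≤ w.1 i := by
    intro w hw i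
    simp only [m]
    split_ifs
    · exact Nat.zero_le _
    · exact hμ i w hw
  have hsum : n ≤ ∑ i, m i + Fintype.card I := by
    by_contra! hlt
    -- A grid point exceeding `m` in every coordinate would contradict dominance. The surplus may go
    -- to any index. Hence `m` has sum at least `n` minus the number of indices, which forces the
    -- grid points of `σ` close together.
    let y : I → ℕ := fun i => m i + 1 + if i = i₁ then n - (∑ i, m i + Fintype.card I) else 0
    have hy : ∑ i, y i = n := by
      simp only [y, Finset.sum_add_distrib, Finset.sum_ite_eq', Finset.mem_univ, if_true,
        Finset.sum_const, Finset.card_univ, smul_eq_mul, mul_one]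
      omega
    obtain ⟨i, hi, hi'⟩ := hlow ⟨y, hmk y hy⟩
    have h1 := hmono i _ _ (hi' _ (hμσ i))
    have h2 : m i = (μ i).1 i := if_neg hi
    have h3 : m i + 1 ≤ y i := Nat.le_add_right _ _
    simp only at h1
    omega
  have hupper : ∀ w : T, Sum.inl w ∈ σ → ∀ i, w.1 i ≤ m i + Fintype.card I := by
    intro w hw i
    have h1 := Finset.add_sum_erase Finset.univ w.1 (Finset.mem_univ i)
    have h2 := Finset.add_sum_erase Finset.univ m (Finset.mem_univ i)
    have h3 := Finset.sum_le_sum (s := Finset.univ.erase i) fun j _ => hm w hw j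
    have h4 := hT w
    omega
  refine ⟨v.1, hT v, fun i => ?_⟩
  by_cases hi : Sum.inr i ∈ σ
  · left
    have h1 := hupper v hv i
    have h2 : m i = 0 := if_pos hi
    omega
  · right
    obtain ⟨w, hw, hwc⟩ := hcolor i hi
    refine ⟨w.1, hT w, hwc, fun j => ?_⟩
    have h1 := hupper v hv j
    have h2 := hupper w hw j
    have h3 := hm v hv j
    have h4 := hm w hw j
    omega

theorem exists_approx_fixedPoint_stdSimplex [Nonempty I] {f : (I → ℝ) → I → ℝ}
    (hf : ContinuousOn f (stdSimplex ℝ I)) (hmaps : Set.MapsTo f (stdSimplex ℝ I) (stdSimplex ℝ I))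
    {ε : ℝ} (hε : 0 < ε) : ∃ v ∈ stdSimplex ℝ I, ∀ i, v i ≤ f v i + ε := by
  have huc := (isCompact_stdSimplex ℝ I).uniformContinuousOn_of_continuous hf
  rw [Metric.uniformContinuousOn_iff] at huc
  obtain ⟨δ, hδ, huc⟩ := huc (ε / 2) (by positivity)
  obtain ⟨n, hn⟩ := exists_nat_gt (max ((Fintype.card I : ℝ) / δ) ((Fintype.card I : ℝ) / (ε / 2)))
  have hcard : (0 : ℝ) < Fintype.card I := by exact_mod_cast Fintype.card_pos
  have hn0 : (0 : ℝ) < n := lt_of_le_of_lt (by positivity) hn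
  have hnδ : (Fintype.card I : ℝ) / n < δ := by
    rw [div_lt_comm₀ hn0 hδ]
    exact (le_max_left _ _).trans_lt hn
  have hnε : (Fintype.card I : ℝ) / n < ε / 2 := by
    rw [div_lt_comm₀ hn0 (by positivity)]
    exact (le_max_right _ _).trans_lt hn
  let p : (I → ℕ) → I → ℝ := fun v i => v i / n
  have hp : ∀ v : I → ℕ, ∑ i, v i = n → p v ∈ stdSimplex ℝ I := by
    intro v hv
    refine ⟨fun i => by positivity, ?_⟩
    rw [← Finset.sum_div, ← Nat.cast_sum, hv, div_self hn0.ne']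
  -- A color is a coordinate that `f` does not decrease; one exists because both points have
  -- coordinate sum 1.
  have hcol : ∀ v : I → ℕ, ∃ i, ∑ i, v i = n → p v i ≤ f (p v) i := by
    intro v
    by_cases hv : ∑ i, v i = n
    · have h1 : ∑ i, p v i ≤ ∑ i, f (p v) i := by
        rw [(hp v hv).2, (hmaps (hp v hv)).2]
      obtain ⟨i, -, hi⟩ := Finset.exists_le_of_sum_le Finset.univ_nonempty h1
      exact ⟨i, fun _ => hi⟩
    · exact ⟨Classical.arbitrary I, fun h => absurd h hv⟩
  choose c hc using hcol
  obtain ⟨v, hv, hvi⟩ := exists_grid_point_near_all_colors n c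
  refine ⟨p v, hp v hv, fun i => ?_⟩
  rcases hvi i with h | ⟨w, hw, rfl, hvw⟩
  · have h1 : p v i ≤ Fintype.card I / n :=
      div_le_div_of_nonneg_right (by exact_mod_cast h) hn0.le
    have h2 := (hmaps (hp v hv)).1 i
    linarith
  · have hclose : ∀ j, p v j ≤ p w j + Fintype.card I / n ∧ p w j ≤ p v j + Fintype.card I / n := by
      intro j
      simp only [p, ← add_div]
      exact ⟨div_le_div_of_nonneg_right (by exact_mod_cast (hvw j).1) hn0.le,
        div_le_div_of_nonneg_right (by exact_mod_cast (hvw j).2) hn0.le⟩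
    have hdist : dist (p w) (p v) < δ := by
      refine lt_of_le_of_lt ((dist_pi_le_iff (by positivity)).2 fun j => ?_) hnδ
      rw [Real.dist_eq, abs_le]
      constructor <;> linarith [hclose j]
    have h1 := (dist_le_pi_dist (f (p w)) (f (p v)) (c w)).trans_lt
      (huc _ (hp w hw) _ (hp v hv) hdist)
    rw [Real.dist_eq, abs_lt] at h1
    linarith [hc w hw, hclose (c w)]

/-- **Brouwer's fixed point theorem** on the standard simplex. -/
theorem exists_fixedPoint_stdSimplex [Nonempty I] {f : (I → ℝ) → I → ℝ}
    (hf : ContinuousOn f (stdSimplex ℝ I))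
    (hmaps : Set.MapsTo f (stdSimplex ℝ I) (stdSimplex ℝ I)) :
    ∃ x ∈ stdSimplex ℝ I, f x = x := by
  -- Total decrease of coordinates under `f`. Its minimum is 0 by the approximate fixed points, and
  -- since coordinate sums agree, no decrease means equality.
  let g : (I → ℝ) → ℝ := fun v => ∑ i, max (v i - f v i) 0
  have hg : ContinuousOn g (stdSimplex ℝ I) := by
    refine continuousOn_finsetSum _ fun i _ => ?_
    exact (((continuous_apply i).continuousOn).sub
      ((continuous_apply i).comp_continuousOn hf)).sup continuousOn_const
  obtain ⟨v₀, hv₀, -⟩ := exists_approx_fixedPoint_stdSimplex hf hmaps one_pos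
  obtain ⟨x, hx, hmin⟩ := (isCompact_stdSimplex ℝ I).exists_isMinOn ⟨v₀, hv₀⟩ hg
  have hgx : g x ≤ 0 := by
    refine le_of_forall_pos_le_add fun ε hε => ?_
    have hcard : (0 : ℝ) < Fintype.card I := by exact_mod_cast Fintype.card_pos
    obtain ⟨v, hv, hvi⟩ := exists_approx_fixedPoint_stdSimplex hf hmaps (div_pos hε hcard)
    calc g x ≤ g v := hmin hv
      _ ≤ ∑ _i : I, ε / Fintype.card I :=
        Finset.sum_le_sum fun i _ => max_le (by linarith [hvi i]) (by positivity)
      _ = 0 + ε := by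
        rw [Finset.sum_const, Finset.card_univ, nsmul_eq_mul]
        field_simp
        ring
  have hle : ∀ i ∈ Finset.univ, x i ≤ f x i := by
    intro i hi
    have h1 : max (x i - f x i) 0 ≤ g x :=
      Finset.single_le_sum (f := fun i => max (x i - f x i) 0) (fun _ _ => le_max_right _ _) hi
    linarith [le_max_left (x i - f x i) 0]
  refine ⟨x, hx, funext fun i => ?_⟩
  exact ((Finset.sum_eq_sum_iff_of_le hle).1 (by rw [hx.2, (hmaps hx).2]) i (Finset.mem_univ i)).symm

end Brouwer

/-! ### Variational inequality by Nash's map -/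

/-- A variational inequality on a compact convex set: a continuous field `L` of linear functionals
has a point `x` at which `L x` is maximized over the set by `x` itself. -/
theorem exists_forall_apply_le_apply_self {V : Type*} [AddCommGroup V] [Module ℝ V]
    [TopologicalSpace V] [ContinuousAdd V] [ContinuousSMul ℝ V] {K : Set V}
    (hK : IsCompact K) (hconv : Convex ℝ K) (hne : K.Nonempty) (L : V → V →ₗ[ℝ] ℝ)
    (hL : ∀ y, Continuous fun x => L x y) (hL' : Continuous fun x => L x x) :
    ∃ x ∈ K, ∀ y ∈ K, L x y ≤ L x x := by
  suffices h : (K ∩ ⋂ y : K, {x | L x y ≤ L x x}).Nonempty by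
    obtain ⟨x, hx, hx'⟩ := h
    exact ⟨x, hx, fun y hy => Set.mem_iInter.1 hx' ⟨y, hy⟩⟩
  refine hK.inter_iInter_nonempty _ (fun y => isClosed_le (hL y) hL') fun u => ?_
  rcases u.eq_empty_or_nonempty with rfl | hu
  · simpa using hne
  have : Nonempty u := hu.to_subtype
  let p : (u → ℝ) → V := fun t => ∑ i, t i • (i.1 : V)
  have hp : Continuous p := continuous_finsetSum _ fun i _ => (continuous_apply i).smul
    continuous_const
  have hpK : ∀ t ∈ stdSimplex ℝ u, p t ∈ K := fun t ht =>
    hconv.sum_mem (fun i _ => ht.1 i) ht.2 fun i _ => i.1.2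
  let d : (u → ℝ) → u → ℝ := fun t i => L (p t) i.1 - L (p t) (p t)
  let g : (u → ℝ) → u → ℝ := fun t i => max (d t i) 0
  have hg0 : ∀ t i, 0 ≤ g t i := fun t i => le_max_right _ _
  have hg : ∀ i, Continuous fun t => g t i := fun i =>
    (((hL i.1).comp hp).sub (hL'.comp hp)).max continuous_const
  have hS : ∀ t, 0 < 1 + ∑ i, g t i := fun t =>
    add_pos_of_pos_of_nonneg one_pos (Finset.sum_nonneg fun i _ => hg0 t i)
  -- Nash's map: weight moves towards test points that improve on `p t`.
  let f : (u → ℝ) → u → ℝ := fun t i => (t i + g t i) / (1 + ∑ j, g t j)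
  have hf : Continuous f := continuous_pi fun i =>
    ((continuous_apply i).add (hg i)).div
      (continuous_const.add (continuous_finsetSum _ fun j _ => hg j)) fun t => (hS t).ne'
  have hmaps : Set.MapsTo f (stdSimplex ℝ u) (stdSimplex ℝ u) := by
    intro t ht
    refine ⟨fun i => div_nonneg (add_nonneg (ht.1 i) (hg0 t i)) (hS t).le, ?_⟩
    simp only [f]
    rw [← Finset.sum_div, Finset.sum_add_distrib, ht.2, div_self (hS t).ne']
  obtain ⟨t, ht, hft⟩ := exists_fixedPoint_stdSimplex hf.continuousOn hmaps
  have hfix : ∀ i, g t i = t i * ∑ j, g t j := by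
    intro i
    have h1 : (t i + g t i) / (1 + ∑ j, g t j) = t i := congrFun hft i
    rw [div_eq_iff (hS t).ne'] at h1
    linarith
  -- By linearity, the gains average to zero under the weights `t`; with `hfix` and `hsq` this kills
  -- all positive gains.
  have hzero : ∑ i, t i * d t i = 0 := by
    simp only [d, mul_sub, Finset.sum_sub_distrib]
    rw [← Finset.sum_mul, ht.2, one_mul, sub_eq_zero]
    simp only [p, map_sum, map_smul, smul_eq_mul]
  have hsq : ∀ i, g t i * d t i = g t i * g t i := by
    intro i
    rcases le_total (d t i) 0 with h | h
    · simp [g, max_eq_right h]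
    · simp [g, max_eq_left h]
  have hsum : ∑ i, g t i * g t i = 0 := by
    calc ∑ i, g t i * g t i = ∑ i, (t i * d t i) * ∑ j, g t j :=
          Finset.sum_congr rfl fun i _ => by rw [← hsq]; nth_rw 1 [hfix i]; ring
      _ = 0 := by rw [← Finset.sum_mul, hzero, zero_mul]
  refine ⟨p t, hpK t ht, Set.mem_iInter₂.2 fun i hi => ?_⟩
  have h1 := (Finset.sum_eq_zero_iff_of_nonneg fun i _ => mul_self_nonneg (g t i)).1 hsum
    ⟨i, hi⟩ (Finset.mem_univ _)
  have h2 : d t ⟨i, hi⟩ ≤ g t ⟨i, hi⟩ := le_max_left _ _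
  rw [mul_self_eq_zero.1 h1] at h2
  exact sub_nonpos.1 h2

/-! ### Kraus operators and the geometry of the strategy sets -/

noncomputable section

namespace StaticQuantumGame

variable {N : ℕ} (G : StaticQuantumGame N)

/-- The chi-matrix of the map with Kraus operators `T`. -/
def krausChi (E : G.OpBasis) (k : Fin N) (T : Fin (4 ^ G.q k) → G.LocalOp k) : G.Chi k :=
  Matrix.of fun α β => ∑ l, (E k).repr (T l) α * star ((E k).repr (T l) β)

theorem sum_star_krausChi (E : G.OpBasis) (k : Fin N) (T : Fin (4 ^ G.q k) → G.LocalOp k) :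
    ∑ α, ∑ β, star (G.krausChi E k T α β) • ((E k α)ᴴ * E k β) = ∑ l, (T l)ᴴ * T l := by
  have h : ∀ l, (T l)ᴴ * T l = ∑ α, ∑ β,
      (star ((E k).repr (T l) α) * (E k).repr (T l) β) • ((E k α)ᴴ * E k β) := by
    intro l
    conv_lhs => rw [← (E k).sum_repr (T l)]
    simp only [Matrix.conjTranspose_sum, Matrix.conjTranspose_smul, Finset.sum_mul_sum,
      Matrix.smul_mul, Matrix.mul_smul, smul_smul, mul_comm]
  simp only [h, krausChi, Matrix.of_apply, star_sum, star_mul', star_star, Finset.sum_smul]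
  rw [Finset.sum_comm]
  conv_rhs => rw [Finset.sum_comm]
  rw [Finset.sum_comm]
  refine Finset.sum_congr rfl fun α _ => ?_
  rw [Finset.sum_comm]

theorem posSemidef_krausChi (E : G.OpBasis) (k : Fin N) (T : Fin (4 ^ G.q k) → G.LocalOp k) :
    (G.krausChi E k T).PosSemidef := by
  have : G.krausChi E k T = (Matrix.of fun α l => (E k).repr (T l) α) *
      (Matrix.of fun α l => (E k).repr (T l) α)ᴴ := by
    ext α β
    simp [krausChi, Matrix.mul_apply]
  rw [this]
  exact Matrix.posSemidef_self_mul_conjTranspose _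

-- Write χ = Bᴴ * B; the conjugated rows of the square matrix B are the coordinates of the Kraus
-- operators, so `4 ^ q k` of them suffice.
open scoped MatrixOrder Matrix.Norms.L2Operator in
theorem exists_eq_krausChi (E : G.OpBasis) (k : Fin N) {χ : G.Chi k} (hχ : χ.PosSemidef) :
    ∃ T, G.krausChi E k T = χ := by
  obtain ⟨B, rfl⟩ := CStarAlgebra.nonneg_iff_eq_star_mul_self.1 hχ.nonneg
  refine ⟨fun l => ∑ α, star (B l α) • E k α, ?_⟩
  ext α β
  simp only [krausChi, Matrix.of_apply, Matrix.mul_apply, Matrix.star_apply]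
  refine Finset.sum_congr rfl fun l _ => ?_
  rw [(E k).repr_sum_self, star_star]

theorem Ω_eq_image (E : G.OpBasis) (k : Fin N) :
    G.Ω E k = G.krausChi E k '' {T | ∑ l, (T l)ᴴ * T l = 1} := by
  ext χ
  constructor
  · rintro ⟨hχ, hsum⟩
    obtain ⟨T, rfl⟩ := G.exists_eq_krausChi E k hχ
    exact ⟨T, by rwa [sum_star_krausChi] at hsum, rfl⟩
  · rintro ⟨T, hT, rfl⟩
    exact ⟨G.posSemidef_krausChi E k T, by rw [sum_star_krausChi]; exact hT⟩

theorem continuous_krausChi (E : G.OpBasis) (k : Fin N) : Continuous (G.krausChi E k) := by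
  have h : ∀ α, Continuous fun T : G.LocalOp k => (E k).repr T α := fun α =>
    ((E k).coord α).continuous_of_finiteDimensional
  refine continuous_matrix fun α β => ?_
  simp only [krausChi, Matrix.of_apply]
  refine continuous_finsetSum _ fun l _ => ?_
  exact ((h α).comp (continuous_apply l)).mul ((h β).comp (continuous_apply l)).star

end StaticQuantumGame

theorem isCompact_setOf_sum_conjTranspose_mul_self_eq_one (ι n : Type*) [Fintype ι] [Fintype n]
    [DecidableEq n] : IsCompact {T : ι → Matrix n n ℂ | ∑ l, (T l)ᴴ * T l = 1} := by
  have hcpt : IsCompact (Set.univ.pi fun _ : ι => Set.univ.pi fun _ : n => Set.univ.pi fun _ : n =>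
      Metric.closedBall (0 : ℂ) 1) :=
    isCompact_univ_pi fun _ => isCompact_univ_pi fun _ => isCompact_univ_pi fun _ =>
      isCompact_closedBall _ _
  refine hcpt.of_isClosed_subset ?_ ?_
  · refine isClosed_eq (continuous_finsetSum _ fun l _ => ?_) continuous_const
    exact (continuous_apply l).matrix_conjTranspose.matrix_mul (continuous_apply l)
  · intro (T : ι → Matrix n n ℂ) hT l _ i _ j _
    -- This is the diagonal entry `(j, j)` of the constraint; it bounds every matrix entry by 1.
    have h1 : ∑ l, ∑ i, ‖T l i j‖ ^ 2 = 1 := by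
      have h2 := congrArg Complex.re (congrFun (congrFun hT j) j)
      rw [Matrix.one_apply_eq, Complex.one_re] at h2
      rw [← h2, Matrix.sum_apply, Complex.re_sum]
      refine Finset.sum_congr rfl fun l _ => ?_
      rw [Matrix.mul_apply, Complex.re_sum]
      refine Finset.sum_congr rfl fun i _ => ?_
      rw [← Complex.normSq_eq_norm_sq, ← Complex.ofReal_re (Complex.normSq _),
        Complex.normSq_eq_conj_mul_self]
      rfl
    have h2 : ‖T l i j‖ ^ 2 ≤ 1 := by
      rw [← h1]
      refine (Finset.single_le_sum (f := fun i => ‖T l i j‖ ^ 2) (fun _ _ => by positivity)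
        (Finset.mem_univ i)).trans ?_
      exact Finset.single_le_sum (f := fun l => ∑ i, ‖T l i j‖ ^ 2)
        (fun _ _ => Finset.sum_nonneg fun _ _ => by positivity) (Finset.mem_univ l)
    rw [mem_closedBall_zero_iff]
    exact (sq_le_one_iff₀ (norm_nonneg _)).1 h2

namespace StaticQuantumGame

variable {N : ℕ} (G : StaticQuantumGame N)

theorem isCompact_Ω (E : G.OpBasis) (k : Fin N) : IsCompact (G.Ω E k) := by
  rw [Ω_eq_image]
  exact (isCompact_setOf_sum_conjTranspose_mul_self_eq_one _ _).image (G.continuous_krausChi E k)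

theorem nonempty_Ω (E : G.OpBasis) (k : Fin N) : (G.Ω E k).Nonempty := by
  rw [Ω_eq_image]
  obtain ⟨l₀⟩ : Nonempty (Fin (4 ^ G.q k)) := ⟨⟨0, by positivity⟩⟩
  -- The identity channel: one Kraus operator is 1, the others vanish.
  refine Set.Nonempty.image _ ⟨Pi.single l₀ 1, ?_⟩
  rw [Set.mem_ofPred_eq, Finset.sum_eq_single l₀]
  · simp
  · intro l _ hl
    simp [hl]
  · simp

theorem convex_Ω (E : G.OpBasis) (k : Fin N) : Convex ℝ (G.Ω E k) := by
  rintro χ ⟨hχ, hχ'⟩ ψ ⟨hψ, hψ'⟩ a b ha hb hab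
  refine ⟨(hχ.smul ha).add (hψ.smul hb), ?_⟩
  have h : ∀ α β, star ((a • χ + b • ψ) α β) • ((E k α)ᴴ * E k β) =
      a • (star (χ α β) • ((E k α)ᴴ * E k β)) + b • (star (ψ α β) • ((E k α)ᴴ * E k β)) := by
    intro α β
    simp only [Matrix.add_apply, Matrix.smul_apply, star_add, star_smul, star_trivial, add_smul,
      smul_assoc]
  simp only [h, Finset.sum_add_distrib, ← Finset.smul_sum, hχ', hψ']
  rw [← add_smul, hab, one_smul]

theorem prod_update (k : Fin N) (χ : ∀ j, G.Chi j) (x : G.Chi k) (α β : ∀ j, Fin (4 ^ G.q j)) :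
    ∏ j, Function.update χ k x j (α j) (β j) =
      x (α k) (β k) * ∏ j ∈ Finset.univ.erase k, χ j (α j) (β j) := by
  rw [← Finset.mul_prod_erase _ _ (Finset.mem_univ k), Function.update_self]
  congr 1
  refine Finset.prod_congr rfl fun j hj => ?_
  rw [Function.update_of_ne (Finset.ne_of_mem_erase hj)]

/-- The payoff of player `k` at the profile obtained from `χ` by changing the strategy of player
`k`, as a linear function of the new strategy. -/
def deviationPayoff (E : G.OpBasis) (k : Fin N) (χ : ∀ j, G.Chi j) : G.Chi k →ₗ[ℝ] ℝ where
  toFun x := G.payoff E k (Function.update χ k x)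
  map_add' x y := by
    simp only [payoff, ← Finset.sum_add_distrib, ← Complex.add_re, ← add_mul]
    refine Finset.sum_congr rfl fun α _ => Finset.sum_congr rfl fun β _ => ?_
    rw [prod_update, prod_update, prod_update, Matrix.add_apply, add_mul (x _ _)]
  map_smul' a x := by
    simp only [payoff, RingHom.id_apply, smul_eq_mul, Finset.mul_sum]
    refine Finset.sum_congr rfl fun α _ => Finset.sum_congr rfl fun β _ => ?_
    rw [prod_update, prod_update, Matrix.smul_apply, ← Complex.re_ofReal_mul, Complex.real_smul]
    congr 1
    ring

theorem continuous_payoff (E : G.OpBasis) (k : Fin N) : Continuous (G.payoff E k) := by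
  refine continuous_finsetSum _ fun α _ => continuous_finsetSum _ fun β _ => ?_
  refine Complex.continuous_re.comp (Continuous.mul ?_ continuous_const)
  exact continuous_finsetProd _ fun j _ => (continuous_apply j).matrix_elem _ _

end StaticQuantumGame

end

/-! ### Existence of an equilibrium -/

theorem theorem1 (N : ℕ) (G : StaticQuantumGame N) (E : G.OpBasis) :
    ∃ χ : (∀ k, G.Chi k), G.IsNashEquilibrium E χ := by
  let L : (∀ k, G.Chi k) → (∀ k, G.Chi k) →ₗ[ℝ] ℝ := fun χ =>
    ∑ k, G.deviationPayoff E k χ ∘ₗ LinearMap.proj k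
  have hLapp : ∀ χ ψ, L χ ψ = ∑ k, G.payoff E k (Function.update χ k (ψ k)) := by
    intro χ ψ
    simp only [L, LinearMap.sum_apply]
    rfl
  have hLself : ∀ χ, L χ χ = ∑ k, G.payoff E k χ := fun χ => by
    simp only [hLapp, Function.update_eq_self]
  obtain ⟨χ, hχ, hmax⟩ := exists_forall_apply_le_apply_self
    (isCompact_univ_pi fun k => G.isCompact_Ω E k)
    (convex_pi fun k _ => G.convex_Ω E k) (Set.univ_pi_nonempty_iff.2 fun k => G.nonempty_Ω E k) L
    (fun ψ => by
      simp only [hLapp]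
      exact continuous_finsetSum _ fun k _ =>
        (G.continuous_payoff E k).comp (continuous_id.update k continuous_const))
    (by
      simp only [hLself]
      exact continuous_finsetSum _ fun k _ => G.continuous_payoff E k)
  refine ⟨χ, fun k => ⟨hχ k (Set.mem_univ k), fun y hy => ?_⟩⟩
  -- For this unilateral deviation, all summands of `L` except the `k`-th agree with those at `χ`
  -- and cancel.
  have h1 := hmax (Function.update χ k y) fun j _ => by
    by_cases hj : j = k
    · subst hj
      rwa [Function.update_self]
    · rw [Function.update_of_ne hj]
      exact hχ j (Set.mem_univ j)
  rw [hLself, hLapp, ← Finset.add_sum_erase _ _ (Finset.mem_univ k),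
    ← Finset.add_sum_erase _ (fun k => G.payoff E k χ) (Finset.mem_univ k),
    Function.update_self, Finset.sum_congr rfl fun j hj => by
      rw [Function.update_of_ne (Finset.ne_of_mem_erase hj), Function.update_eq_self]] at h1
  rw [Function.update_eq_self]
  exact le_of_add_le_add_right h1
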